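/- There is a constant $C>0$ such that for every $n$ and every $n$-qubit pure state $|\psi\rangle$ (a unit vector in $(\mathbb{C}^2)^{\otimes n}$), there is a circuit on $n$ qubits, consisting of at most $C\cdot 2^n$ gates, each of which is either a one-qubit unitary gate acting on one of the qubits or a CNOT gate with arbitrary distinct control and target qubits, that prepares $|\psi\rangle$ from $|0\rangle=|0\cdots0\rangle$; that is, the unitary operator $u$ computed by the circuit satisfies $u|0\rangle = e^{i\theta}|\psi\rangle$ for some $\theta\in\mathbb{R}$. In other words, an arbitrary $n$-qubit pure state can be prepared from $|0\rangle$ using $O(2^n)$ gates. -/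

import Mathlib

namespace QCircuit

/-- Labels of the computational basis of `n` qubits: bit strings of length `n`. -/
abbrev Bits (n : ℕ) : Type := Fin n → Fin 2

/-- The `2 ^ n`-dimensional Hilbert space of `n` qubits. -/
abbrev Qubits (n : ℕ) : Type := EuclideanSpace ℂ (Bits n)

/-- The basis vector `|0⟩ = |0…0⟩`. -/
noncomputable def ketZero (n : ℕ) : Qubits n := EuclideanSpace.single (0 : Bits n) 1

/-- The gates allowed in a circuit on `n` qubits: an arbitrary one-qubit unitary acting on one of
the qubits, or a CNOT with distinct control and target qubits. -/
inductive Gate (n : ℕ) : Type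
  | oneQubit (i : Fin n) (u : Matrix.unitaryGroup (Fin 2) ℂ) : Gate n
  | cnot (control target : Fin n) (h : control ≠ target) : Gate n

/-- The matrix of a gate in the computational basis (row index `x`, column index `y`).
A one-qubit gate acts as `u` on qubit `i` and as the identity on the other qubits. A CNOT sends
`|y⟩` to the basis vector in which the target bit of `y` has the control bit added modulo 2. -/
noncomputable def Gate.toMatrix {n : ℕ} : Gate n → Matrix (Bits n) (Bits n) ℂ
  | .oneQubit i u => Matrix.of fun x y =>
      if ∀ j, j ≠ i → x j = y j then (u : Matrix (Fin 2) (Fin 2) ℂ) (x i) (y i) else 0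
  | .cnot c t _ => Matrix.of fun x y =>
      if x = Function.update y t (y t + y c) then 1 else 0

/-- A circuit on `n` qubits is a finite sequence of gates, the first of which is applied first.
Its number of gates is the length of the list. -/
abbrev Circuit (n : ℕ) : Type := List (Gate n)

/-- The matrix of the operator computed by a circuit. -/
noncomputable def Circuit.toMatrix {n : ℕ} : Circuit n → Matrix (Bits n) (Bits n) ℂ
  | [] => 1
  | g :: gs => Circuit.toMatrix gs * g.toMatrix

/-- The circuit `c` prepares `ψ` from `|0⟩`: its operator sends `|0⟩` to `ψ` up to a global
phase. -/
def Prepares {n : ℕ} (c : Circuit n) (ψ : Qubits n) : Prop :=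
  ∃ θ : ℝ, Matrix.toEuclideanLin (Circuit.toMatrix c) (ketZero n) =
    Complex.exp (θ * Complex.I) • ψ

end QCircuit

open Matrix

namespace QCircuit

variable {n : ℕ}

/-! Qubits are disentangled one at a time. Fix the bits in `S`: the two amplitudes along a further
qubit `i` form a vector in ℂ², which is a scalar times the first column of some `rotZ β * rotY γ`
(`exists_rotZ_mul_rotY`). So the state is two multiplexed rotations applied to a state with qubit
`i` at 0. Each costs less than `3 * 2 ^ #S` gates (`exists_circuit_mux`), and these costs sum
geometrically to `6 * 2 ^ n` (`exists_circuit_of_support`). Norms are ignored until the end, where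
unitarity makes the leftover scalar a phase. -/

theorem Circuit.toMatrix_append (c d : Circuit n) :
    Circuit.toMatrix (c ++ d) = Circuit.toMatrix d * Circuit.toMatrix c := by
  induction c with
  | nil => simp [Circuit.toMatrix]
  | cons g gs ih => simp [Circuit.toMatrix, ih, Matrix.mul_assoc]

/-- The multiplexed one-qubit operator that acts on qubit `i` by a matrix depending on the
basis label. -/
def mux (i : Fin n) (V : Bits n → Matrix (Fin 2) (Fin 2) ℂ) (f : Bits n → ℂ) : Bits n → ℂ :=
  fun x => ∑ b, V x (x i) b * f (Function.update x i b)

theorem oneQubit_mulVec (i : Fin n) (u : Matrix.unitaryGroup (Fin 2) ℂ) (f : Bits n → ℂ) :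
    (Gate.oneQubit i u).toMatrix *ᵥ f = mux i (fun _ => u) f := by
  ext x
  simp only [mulVec, dotProduct, Gate.toMatrix, of_apply, mux, ite_mul, zero_mul]
  rw [← Finset.sum_filter]
  symm
  refine Finset.sum_bij (fun b _ => Function.update x i b) ?_ ?_ ?_ ?_
  · intro b _
    simp only [Finset.mem_filter, Finset.mem_univ, true_and]
    intro j hj
    simp [hj]
  · intro a _ b _ h
    simpa using congrFun h i
  · intro y hy
    simp only [Finset.mem_filter, Finset.mem_univ, true_and] at hy
    refine ⟨y i, Finset.mem_univ _, ?_⟩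
    ext j
    by_cases hj : j = i
    · subst hj; simp
    · simp [hj, hy j hj]
  · intro b _
    simp

theorem Fin2.add_add_self (a b : Fin 2) : a + b + b = a := by
  revert a b; decide

theorem cnot_mulVec (c t : Fin n) (h : c ≠ t) (f : Bits n → ℂ) :
    (Gate.cnot c t h).toMatrix *ᵥ f = fun x => f (Function.update x t (x t + x c)) := by
  ext x
  simp only [mulVec, dotProduct, Gate.toMatrix, of_apply, ite_mul, zero_mul, one_mul]
  rw [Finset.sum_eq_single (Function.update x t (x t + x c))]
  · simp [h, Fin2.add_add_self]
  · intro y _ hy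
    rw [if_neg]
    rintro rfl
    apply hy
    simp [h, Fin2.add_add_self]
  · simp

/-- Since `W` ignores bit `i`, both operators are block diagonal with the same 2 × 2 blocks. -/
theorem mux_mux (i : Fin n) (V W : Bits n → Matrix (Fin 2) (Fin 2) ℂ)
    (hW : ∀ x b, W (Function.update x i b) = W x) (f : Bits n → ℂ) :
    mux i V (mux i W f) = mux i (fun x => V x * W x) f := by
  ext x
  simp [mux, hW, Matrix.mul_apply]
  ring

theorem mux_one (i : Fin n) (f : Bits n → ℂ) : mux i (fun _ => 1) f = f := by
  ext x
  simp [mux, Matrix.one_apply]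

theorem Gate.conjTranspose_mul_self (g : Gate n) : g.toMatrixᴴ * g.toMatrix = 1 := by
  refine Matrix.toLin'.injective (LinearMap.ext fun f => ?_)
  cases g with
  | oneQubit i u =>
    have h : ((Gate.oneQubit i u).toMatrix)ᴴ = (Gate.oneQubit i (star u)).toMatrix := by
      ext x y
      simp only [Gate.toMatrix, conjTranspose_apply, of_apply]
      simp only [eq_comm (a := x _)]
      split_ifs <;> simp [Matrix.star_apply]
    rw [h]
    simp only [toLin'_apply, one_mulVec, ← mulVec_mulVec, oneQubit_mulVec]
    rw [mux_mux _ _ _ (by simp)]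
    simp [mux_one]
  | cnot c t hct =>
    have h : ((Gate.cnot c t hct).toMatrix)ᴴ = (Gate.cnot c t hct).toMatrix := by
      ext x y
      have : y = Function.update x t (x t + x c) ↔ x = Function.update y t (y t + y c) := by
        constructor <;> rintro rfl <;> simp [hct, Fin2.add_add_self]
      simp only [Gate.toMatrix, conjTranspose_apply, of_apply, this]
      split_ifs <;> simp
    rw [h]
    simp only [toLin'_apply, one_mulVec, ← mulVec_mulVec, cnot_mulVec]
    simp [hct, Fin2.add_add_self]

theorem Circuit.conjTranspose_mul_self (c : Circuit n) :
    (Circuit.toMatrix c)ᴴ * Circuit.toMatrix c = 1 := by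
  induction c with
  | nil => simp [Circuit.toMatrix]
  | cons g gs ih =>
    rw [Circuit.toMatrix, conjTranspose_mul, Matrix.mul_assoc, ← Matrix.mul_assoc _ _ g.toMatrix,
      ih, Matrix.one_mul, Gate.conjTranspose_mul_self]

theorem Circuit.norm_toEuclideanLin (c : Circuit n) (v : Qubits n) :
    ‖Matrix.toEuclideanLin (Circuit.toMatrix c) v‖ = ‖v‖ := by
  have h : inner ℂ (Matrix.toEuclideanLin (Circuit.toMatrix c) v)
      (Matrix.toEuclideanLin (Circuit.toMatrix c) v) = inner ℂ v v := by
    rw [← LinearMap.adjoint_inner_right, ← Matrix.toEuclideanLin_conjTranspose_eq_adjoint]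
    congr 1
    ext x
    simp [Matrix.toLpLin_apply, Circuit.conjTranspose_mul_self]
  rw [inner_self_eq_norm_sq_to_K, inner_self_eq_norm_sq_to_K] at h
  have h' : ‖Matrix.toEuclideanLin (Circuit.toMatrix c) v‖ ^ 2 = ‖v‖ ^ 2 := by exact_mod_cast h
  exact (sq_eq_sq₀ (norm_nonneg _) (norm_nonneg _)).1 h'

/-- A one-parameter family of unitaries that conjugation by `X` inverts can be multiplexed over a
set `S` of control qubits with fewer than `3 * 2 ^ #S` gates. -/
theorem exists_circuit_mux (R : ℝ → Matrix.unitaryGroup (Fin 2) ℂ)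
    (hadd : ∀ a b, R (a + b) = R a * R b)
    (hneg : ∀ a s t, (R a : Matrix (Fin 2) (Fin 2) ℂ) (s + 1) (t + 1) =
      (R (-a) : Matrix (Fin 2) (Fin 2) ℂ) s t)
    (i : Fin n) (S : Finset (Fin n)) (hi : i ∉ S) (α : Bits n → ℝ) (hα : DependsOn α S) :
    ∃ c : Circuit n, c.length + 2 ≤ 3 * 2 ^ S.card ∧
      ∀ f, Circuit.toMatrix c *ᵥ f = mux i (fun x => R (α x)) f := by
  induction S using Finset.induction_on generalizing α with
  | empty =>
    refine ⟨[Gate.oneQubit i (R (α 0))], by simp, fun f => ?_⟩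
    have h : ∀ x, α x = α 0 := fun x => hα (by simp)
    simp [Circuit.toMatrix, oneQubit_mulVec, h]
  | insert k S hk ih =>
    have hiS : i ∉ S := fun h => hi (Finset.mem_insert_of_mem h)
    have hki : k ≠ i := fun h => hi (h ▸ Finset.mem_insert_self k S)
    have hdep : ∀ b, DependsOn (fun x => α (Function.update x k b)) (S : Set (Fin n)) := by
      intro b x y hxy
      apply hα
      intro j hj
      by_cases hjk : j = k
      · subst hjk; simp
      · have : j ∈ S := by simpa [hjk] using hj
        simp [hjk, hxy j (by simpa using this)]
    obtain ⟨p, hp, hpf⟩ := ih hiS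
      (fun x => (α (Function.update x k 0) + α (Function.update x k 1)) / 2)
      (fun x y hxy => by
        have h0 := hdep 0 hxy
        have h1 := hdep 1 hxy
        simp only at h0 h1 ⊢
        rw [h0, h1])
    obtain ⟨q, hq, hqf⟩ := ih hiS
      (fun x => (α (Function.update x k 0) - α (Function.update x k 1)) / 2)
      (fun x y hxy => by
        have h0 := hdep 0 hxy
        have h1 := hdep 1 hxy
        simp only at h0 h1 ⊢
        rw [h0, h1])
    have hdi : ∀ b x a, α (Function.update (Function.update x i a) k b) =
        α (Function.update x k b) := fun b x a =>
      hdep b fun j hj => Function.update_of_ne (by rintro rfl; exact hiS hj) _ _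
    -- The CNOTs conjugate `q` by `X` exactly when bit `k` is 1, negating its half-difference angle;
    -- adding the half-sum angle of `p` gives `α`. The slack of 2 in the bound pays for the CNOTs.
    refine ⟨[Gate.cnot k i hki] ++ q ++ [Gate.cnot k i hki] ++ p, ?_, fun f => ?_⟩
    · simp only [List.length_append, List.length_singleton,
        Finset.card_insert_of_notMem hk, pow_succ]
      omega
    have hconj : (Gate.cnot k i hki).toMatrix *ᵥ Circuit.toMatrix q *ᵥ
        (Gate.cnot k i hki).toMatrix *ᵥ f = mux i (fun x => R (if x k = 0 then
          (α (Function.update x k 0) - α (Function.update x k 1)) / 2 else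
          -((α (Function.update x k 0) - α (Function.update x k 1)) / 2))) f := by
      ext x
      simp only [hqf, cnot_mulVec, mux, Function.update_self, Function.update_of_ne hki,
        Function.update_idem, hdi]
      rcases Fin.exists_fin_two.1 ⟨x k, rfl⟩ with h | h
      · simp [h]
      · simp [h, ← hneg, add_comm]
    have hsingle : ∀ g : Gate n, Circuit.toMatrix [g] = g.toMatrix := fun g => by
      simp [Circuit.toMatrix]
    rw [Circuit.toMatrix_append, Circuit.toMatrix_append, Circuit.toMatrix_append, hsingle,
      ← mulVec_mulVec, ← mulVec_mulVec, ← mulVec_mulVec, hconj, hpf,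
      mux_mux _ _ _ (by simp [hdi, Function.update_of_ne hki])]
    congr 1
    ext1 x
    rw [← Submonoid.coe_mul, ← hadd]
    congr 2
    rcases Fin.exists_fin_two.1 ⟨x k, rfl⟩ with h | h
    · have hx : Function.update x k 0 = x := by rw [← h, Function.update_eq_self]
      rw [if_pos h, hx]
      ring
    · have hx : Function.update x k 1 = x := by rw [← h, Function.update_eq_self]
      rw [if_neg (by rw [h]; decide), hx]
      ring

/-- The rotation with matrix `!![cos a, -sin a; sin a, cos a]`. -/
noncomputable def rotY (a : ℝ) : Matrix.unitaryGroup (Fin 2) ℂ :=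
  ⟨!![(Real.cos a : ℂ), -(Real.sin a : ℂ); (Real.sin a : ℂ), (Real.cos a : ℂ)], by
    have h := Complex.cos_sq_add_sin_sq (a : ℂ)
    rw [Matrix.mem_unitaryGroup_iff]
    ext s t
    fin_cases s <;> fin_cases t <;>
      simp [Matrix.mul_apply, Matrix.star_apply, ← Complex.cos_conj, ← Complex.sin_conj] <;>
      first | ring1 | linear_combination h⟩

/-- The diagonal gate with phases `exp (-i a)` and `exp (i a)`. -/
noncomputable def rotZ (a : ℝ) : Matrix.unitaryGroup (Fin 2) ℂ :=
  ⟨!![Complex.exp (-(a * Complex.I)), 0; 0, Complex.exp (a * Complex.I)], by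
    rw [Matrix.mem_unitaryGroup_iff]
    ext s t
    fin_cases s <;> fin_cases t <;>
      simp [Matrix.mul_apply, Matrix.star_apply, ← Complex.exp_conj, ← Complex.exp_add]⟩

theorem rotY_add (a b : ℝ) : rotY (a + b) = rotY a * rotY b := by
  ext s t
  fin_cases s <;> fin_cases t <;>
    simp [rotY, Complex.cos_add, Complex.sin_add] <;> ring

theorem rotZ_add (a b : ℝ) : rotZ (a + b) = rotZ a * rotZ b := by
  ext s t
  fin_cases s <;> fin_cases t <;>
    simp [rotZ, ← Complex.exp_add] <;> ring_nf

theorem rotY_flip (a : ℝ) (s t : Fin 2) : (rotY a : Matrix (Fin 2) (Fin 2) ℂ) (s + 1) (t + 1) =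
    (rotY (-a) : Matrix (Fin 2) (Fin 2) ℂ) s t := by
  fin_cases s <;> fin_cases t <;> simp [rotY]

theorem rotZ_flip (a : ℝ) (s t : Fin 2) : (rotZ a : Matrix (Fin 2) (Fin 2) ℂ) (s + 1) (t + 1) =
    (rotZ (-a) : Matrix (Fin 2) (Fin 2) ℂ) s t := by
  fin_cases s <;> fin_cases t <;> simp [rotZ]

theorem exists_rotZ_mul_rotY (v : Fin 2 → ℂ) : ∃ (β γ : ℝ) (w : ℂ), ∀ s,
    v s = (rotZ β * rotY γ : Matrix (Fin 2) (Fin 2) ℂ) s 0 * w := by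
  -- The polar angle of the two moduli is the `rotY` angle; `rotZ` takes half the phase difference,
  -- and `w` the norm and mean phase.
  set z : ℂ := ⟨‖v 0‖, ‖v 1‖⟩ with hz
  refine ⟨((v 1).arg - (v 0).arg) / 2, z.arg,
    ‖z‖ * Complex.exp (((v 0).arg + (v 1).arg) / 2 * Complex.I), fun s => ?_⟩
  have hc : (‖z‖ : ℂ) * Complex.cos z.arg = ‖v 0‖ := by
    rw [← Complex.ofReal_cos, ← Complex.ofReal_mul, Complex.norm_mul_cos_arg]
  have hs : (‖z‖ : ℂ) * Complex.sin z.arg = ‖v 1‖ := by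
    rw [← Complex.ofReal_sin, ← Complex.ofReal_mul, Complex.norm_mul_sin_arg]
  fin_cases s
  · have he : Complex.exp (-(((v 1).arg - (v 0).arg) / 2 * Complex.I)) *
        Complex.exp (((v 0).arg + (v 1).arg) / 2 * Complex.I) =
        Complex.exp ((v 0).arg * Complex.I) := by
      rw [← Complex.exp_add]; ring_nf
    simp [rotZ, rotY, Matrix.mul_apply]
    conv_lhs => rw [← Complex.norm_mul_exp_arg_mul_I (v 0), ← he, ← hc]
    ring
  · have he : Complex.exp (((v 1).arg - (v 0).arg) / 2 * Complex.I) *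
        Complex.exp (((v 0).arg + (v 1).arg) / 2 * Complex.I) =
        Complex.exp ((v 1).arg * Complex.I) := by
      rw [← Complex.exp_add]; ring_nf
    simp [rotZ, rotY, Matrix.mul_apply]
    conv_lhs => rw [← Complex.norm_mul_exp_arg_mul_I (v 1), ← he, ← hs]
    ring

/-- A vector supported on labels vanishing outside `S` is, up to a scalar, prepared by at most
`6 * 2 ^ #S` gates. -/
theorem exists_circuit_of_support (S : Finset (Fin n)) (f : Bits n → ℂ)
    (hf : ∀ x, f x ≠ 0 → ∀ j ∉ S, x j = 0) :
    ∃ c : Circuit n, c.length ≤ 6 * 2 ^ S.card ∧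
      ∃ z : ℂ, f = Circuit.toMatrix c *ᵥ Pi.single 0 z := by
  induction S using Finset.induction_on generalizing f with
  | empty =>
    refine ⟨[], by simp, f 0, ?_⟩
    ext x
    by_cases hx : x = 0
    · subst hx; simp [Circuit.toMatrix]
    · have : f x = 0 := by
        by_contra h
        exact hx (funext fun j => hf x h j (by simp))
      simp [Circuit.toMatrix, hx, this]
  | insert i S hi ih =>
    choose B G W hBGW using exists_rotZ_mul_rotY
    let r : Bits n → Bits n := fun x j => if j ∈ S then x j else 0
    let v : Bits n → Fin 2 → ℂ := fun x b => f (Function.update (r x) i b)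
    have hv : DependsOn v S := by
      intro x y hxy
      have : r x = r y := by
        ext1 j
        by_cases hj : j ∈ S
        · simp [r, hj, hxy j hj]
        · simp [r, hj]
      simp [v, this]
    -- The residual state: qubit `i` is 0, so only column 0 of each block matters.
    let g : Bits n → ℂ := fun x => if ∀ j ∉ S, x j = 0 then W (v x) else 0
    obtain ⟨c, hc, z, hz⟩ := ih g (fun x hx => by
      by_contra h
      exact hx (if_neg h))
    obtain ⟨p, hp, hpf⟩ := exists_circuit_mux rotY rotY_add rotY_flip i S hi (fun x => G (v x))
      (fun x y hxy => by simp only [hv hxy])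
    obtain ⟨q, hq, hqf⟩ := exists_circuit_mux rotZ rotZ_add rotZ_flip i S hi (fun x => B (v x))
      (fun x y hxy => by simp only [hv hxy])
    have hvu : ∀ x b, v (Function.update x i b) = v x := fun x b =>
      hv fun j hj => Function.update_of_ne (by rintro rfl; exact hi hj) _ _
    refine ⟨c ++ p ++ q, ?_, z, ?_⟩
    · simp only [List.length_append, Finset.card_insert_of_notMem hi, pow_succ]
      omega
    rw [Circuit.toMatrix_append, Circuit.toMatrix_append, ← mulVec_mulVec, ← mulVec_mulVec, ← hz,
      hpf, hqf, mux_mux _ _ _ (by simp [hvu])]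
    ext x
    have hg1 : g (Function.update x i 1) = 0 := by
      apply if_neg
      intro h
      simpa using h i hi
    rw [mux, Fin.sum_univ_two, hg1, mul_zero, add_zero]
    by_cases hx : ∀ j ∉ insert i S, x j = 0
    · have hg0 : g (Function.update x i 0) = W (v x) := by
        rw [← hvu x 0]
        apply if_pos
        intro j hj
        by_cases hji : j = i
        · subst hji; simp
        · simpa [hji] using hx j (by simp [hji, hj])
      rw [hg0, ← hBGW]
      congr 1
      ext1 j
      by_cases hji : j = i
      · subst hji; simp
      · by_cases hj : j ∈ S
        · simp [hji, r, hj]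
        · simpa [hji, r, hj] using hx j (by simp [hji, hj])
    · have hg0 : g (Function.update x i 0) = 0 := by
        apply if_neg
        intro h
        apply hx
        intro j hj
        rw [Finset.mem_insert, not_or] at hj
        simpa [hj.1] using h j hj.2
      rw [hg0, mul_zero]
      by_contra h
      exact hx (hf x h)

end QCircuit

open QCircuit in
theorem mainTheorem6 :
    ∃ C : ℝ, 0 < C ∧ ∀ (n : ℕ) (ψ : QCircuit.Qubits n), ‖ψ‖ = 1 →
      ∃ c : QCircuit.Circuit n, (c.length : ℝ) ≤ C * 2 ^ n ∧ QCircuit.Prepares c ψ := by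
  refine ⟨6, by norm_num, fun n ψ hψ => ?_⟩
  obtain ⟨c, hc, z, hz⟩ := exists_circuit_of_support Finset.univ (fun x => ψ x) (by simp)
  refine ⟨c, ?_, -z.arg, ?_⟩
  · rw [Finset.card_univ, Fintype.card_fin] at hc
    exact_mod_cast hc
  have h : ψ = z • Matrix.toEuclideanLin (Circuit.toMatrix c) (ketZero n) := by
    rw [← map_smul]
    ext x
    rw [show ψ x = _ from congrFun hz x]
    simp [Matrix.toLpLin_apply, ketZero, mul_comm]
  -- Circuits preserve norms, and both `ψ` and `ketZero n` are unit vectors.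
  have hz1 : ‖z‖ = 1 := by
    have := congrArg norm h
    rw [norm_smul, Circuit.norm_toEuclideanLin, hψ] at this
    simpa [ketZero] using this.symm
  have hze : z = Complex.exp (z.arg * Complex.I) := by
    simpa [hz1] using (Complex.norm_mul_exp_arg_mul_I z).symm
  have hphase : Complex.exp ((-z.arg : ℝ) * Complex.I) * z = 1 := by
    calc _ = Complex.exp ((-z.arg : ℝ) * Complex.I) * Complex.exp (z.arg * Complex.I) := by
          rw [← hze]
      _ = 1 := by rw [← Complex.exp_add]; simp
  rw [h, smul_smul, hphase, one_smul]
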